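/- Call a probability distribution $G$ on $[-\infty,\infty)$ non-degenerate if its restriction to $\mathbb{R}$ is neither zero nor concentrated at a single point (mass at $-\infty$ is allowed). For $\rho,k\in\mathbb{R}$ and $u>0$ let $\psi(u)=k\rho^{-1}(u^{\rho}-1)$ if $\rho\neq 0$ and $\psi(u)=k\log u$ if $\rho=0$. For functions $\alpha:(0,\infty)\to(0,\infty)$ and $\beta:(0,\infty)\to\mathbb{R}$ write $\alpha,\beta\in\mathrm{ERV}_{\rho,k}$ if, for every $x>0$, as $t\to\infty$, $$\frac{\alpha(tx)}{\alpha(t)}\to x^{\rho}\qquad\text{and}\qquad\frac{\beta(tx)-\beta(t)}{\alpha(t)}\to\psi(x).$$ The generalized tail kernel with parameters $\rho,k$ associated with $G$ is the transition function $\kappa_G(u,A)=G\big(u^{-\rho}[A-\psi(u)]\big)$, $u>0$, $A\subseteq[-\infty,\infty]$ Borel. Proposition 4.1. Let $K:(0,\infty)\times\mathcal{B}[-\infty,\infty]\to[0,1]$ be a transition function (a probability measure in its second argument, measurable in its first), let $\alpha:(0,\infty)\to(0,\infty)$ and $\beta:(0,\infty)\to\mathbb{R}$ be functions, and let $G$ be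 a non-degenerate probability distribution on $[-\infty,\infty)$ such that, as $t\to\infty$, $$K\big(t,[-\infty,\alpha(t)x+\beta(t)]\big)\Rightarrow G([-\infty,x])\quad\text{on }[-\infty,\infty],$$ where $\Rightarrow$ denotes weak convergence of the probability measures on $[-\infty,\infty]$ with these distribution functions of $x$. Then there exists a family $\{G_u:0<u<\infty\}$ of non-degenerate probability distributions on $[-\infty,\infty)$ such that, for every $u>0$, as $t\to\infty$, $$K\big(tu,[-\infty,\alpha(t)x+\beta(t)]\big)\Rightarrow G_u([-\infty,x])\quad\text{on }[-\infty,\infty],$$ if and only if $\alpha,\beta\in\mathrm{ERV}_{\rho,k}$ for some $\rho,k\in\mathbb{R}$. In this case, with these $\rho,k$, we have $G_1=G$ and $G_u=\kappa_G(u,\cdot)$ for every $u>0$, and $$K\big(tu_t,[-\infty,\alpha(t)x+\beta(t)]\big)\Rightarrow\kappa_G(u,[-\infty,x])\quad\text{on }[-\infty,\infty]$$ whenever $u_t=u(t)>0$ and $u_t\to u\in(0,\infty)$ as $t\to\infty$. -/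

import Mathlib

open MeasureTheory ProbabilityTheory Filter Topology

/-- The half line `(0, ∞)`. -/
abbrev PosReal : Type := {x : ℝ // 0 < x}

/-- The function `ψ(x) = k ρ⁻¹ (x ^ ρ - 1)` for `ρ ≠ 0` and `ψ(x) = k log x` for `ρ = 0`. -/
noncomputable def ervPsi (ρ k : ℝ) (x : PosReal) : ℝ :=
  if ρ = 0 then k * Real.log (x : ℝ) else k * ρ⁻¹ * ((x : ℝ) ^ ρ - 1)

/-- The pair `a : (0, ∞) → (0, ∞)`, `f : (0, ∞) → ℝ` is extended regularly varying with
parameters `ρ, k`. -/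
def IsERV (a : PosReal → PosReal) (f : PosReal → ℝ) (ρ k : ℝ) : Prop :=
  ∀ x : PosReal,
    Tendsto (fun t : PosReal => (a (t * x) : ℝ) / (a t : ℝ)) atTop (𝓝 ((x : ℝ) ^ ρ)) ∧
    Tendsto (fun t : PosReal => (f (t * x) - f t) / (a t : ℝ)) atTop (𝓝 (ervPsi ρ k x))

/-- `[-∞, ∞] ∋ x ↦ (x - b) / a` for `a > 0`; the points `±∞` are fixed. -/
noncomputable def normMap (a : PosReal) (b : ℝ) (x : EReal) : EReal :=
  (x - (b : EReal)) / ((a : ℝ) : EReal)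

theorem measurable_normMap (a : PosReal) (b : ℝ) : Measurable (normMap a b) := by
  apply Monotone.measurable
  intro x y h
  exact EReal.div_le_div_right_of_nonneg (by exact_mod_cast a.2.le)
    (EReal.sub_le_sub h le_rfl)

/-- The law `A ↦ K(y, a A + b)` on `[-∞, ∞]`, that is, the law of `(X - b) / a` when `X` has law
`K(y, ·)`. -/
noncomputable def scaledLaw (K : Kernel PosReal EReal) [IsMarkovKernel K] (y a : PosReal) (b : ℝ) :
    ProbabilityMeasure EReal :=
  ⟨(K y).map (normMap a b), Measure.isProbabilityMeasure_map (measurable_normMap a b).aemeasurable⟩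

/-- The distribution function of `scaledLaw K y a b` is `x ↦ K(y, [-∞, a x + b])`. -/
theorem scaledLaw_Iic (K : Kernel PosReal EReal) [IsMarkovKernel K] (y a : PosReal) (b : ℝ)
    (x : EReal) :
    (scaledLaw K y a b : Measure EReal) (Set.Iic x)
      = K y (Set.Iic (((a : ℝ) : EReal) * x + (b : EReal))) := by
  change ((K y).map (normMap a b)) (Set.Iic x) = _
  rw [Measure.map_apply (measurable_normMap a b) measurableSet_Iic]
  congr 1
  ext z
  have ha : (0 : EReal) < ((a : ℝ) : EReal) := by exact_mod_cast a.2
  simp only [Set.mem_preimage, Set.mem_Iic, normMap]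
  rw [EReal.div_le_iff_le_mul ha (EReal.coe_ne_top _),
    EReal.sub_le_iff_le_add (Or.inl (EReal.coe_ne_bot _)) (Or.inl (EReal.coe_ne_top _))]

/-- A non-degenerate probability distribution on `[-∞, ∞)`: it has no mass at `+∞`, and its
restriction to the real line is neither zero nor concentrated at a single point (equivalently, its
distribution function has at least two points of increase in `ℝ`). Mass at `-∞` is allowed. -/
def IsNondegenerate (G : ProbabilityMeasure EReal) : Prop :=
  (G : Measure EReal) {⊤} = 0 ∧
    ∀ c : ℝ, (G : Measure EReal) ((fun x : ℝ => (x : EReal)) '' {x : ℝ | x ≠ c}) ≠ 0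

/-- The map `(y, x) ↦ y ^ ρ x + ψ(y)` from `(0, ∞) × [-∞, ∞]` to `[-∞, ∞]`. -/
noncomputable def tailMap (ρ k : ℝ) (p : PosReal × EReal) : EReal :=
  (((p.1 : ℝ) ^ ρ : ℝ) : EReal) * p.2 + (ervPsi ρ k p.1 : EReal)

theorem measurable_tailMap (ρ k : ℝ) : Measurable (tailMap ρ k) := by
  have h : Measurable (ervPsi ρ k) := by
    unfold ervPsi
    split_ifs <;> fun_prop
  unfold tailMap
  fun_prop

/-- The generalized tail kernel `κ_G(y, A) = G(y ^ (-ρ) [A - ψ(y)])`, that is, `κ_G(y, ·)` is the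
law of `y ^ ρ ξ + ψ(y)` when `ξ` has law `G`. -/
noncomputable def tailKernel (ρ k : ℝ) (G : ProbabilityMeasure EReal) : Kernel PosReal EReal :=
  (Kernel.id ×ₖ Kernel.const PosReal (G : Measure EReal)).map (tailMap ρ k)

instance (ρ k : ℝ) (G : ProbabilityMeasure EReal) : IsMarkovKernel (tailKernel ρ k G) :=
  Kernel.IsMarkovKernel.map _ (measurable_tailMap ρ k)

/-- `κ_G(y, ·)` as a probability measure. -/
noncomputable def tailLaw (ρ k : ℝ) (G : ProbabilityMeasure EReal) (y : PosReal) :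
    ProbabilityMeasure EReal :=
  ⟨tailKernel ρ k G y, inferInstance⟩

/-- `κ_G(y, A) = G({y ^ (-ρ) (z - ψ(y)) : z ∈ A})` for every Borel set `A`. -/
theorem tailKernel_apply (ρ k : ℝ) (G : ProbabilityMeasure EReal) (y : PosReal) (A : Set EReal)
    (hA : MeasurableSet A) :
    tailKernel ρ k G y A = (G : Measure EReal)
      ((fun z : EReal => (((y : ℝ) ^ (-ρ) : ℝ) : EReal) * (z - (ervPsi ρ k y : EReal))) '' A) := by
  have hc : 0 < (y : ℝ) ^ ρ := Real.rpow_pos_of_pos y.2 ρ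
  rw [tailKernel, Kernel.map_apply' _ (measurable_tailMap ρ k) _ hA, Kernel.prod_apply,
    Kernel.id_apply, Kernel.const_apply, Measure.dirac_prod,
    Measure.map_apply measurable_prodMk_left (measurable_tailMap ρ k hA), Real.rpow_neg y.2.le]
  congr 1
  ext z
  simp only [Set.mem_preimage, tailMap, Set.mem_image]
  generalize ervPsi ρ k y = b
  generalize hcy : (y : ℝ) ^ ρ = c at hc
  have key : ∀ w : EReal,
      ((c⁻¹ : ℝ) : EReal) * (((c : EReal) * w + (b : EReal)) - (b : EReal)) = w := by
    intro w
    induction w with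
    | bot => simp [EReal.coe_mul_bot_of_pos hc, EReal.coe_mul_bot_of_pos (inv_pos.2 hc)]
    | top => simp [EReal.coe_mul_top_of_pos hc, EReal.coe_mul_top_of_pos (inv_pos.2 hc)]
    | coe w => norm_cast; field_simp; ring
  have key' : ∀ w : EReal,
      (c : EReal) * (((c⁻¹ : ℝ) : EReal) * (w - (b : EReal))) + (b : EReal) = w := by
    intro w
    induction w with
    | bot => simp [EReal.coe_mul_bot_of_pos hc, EReal.coe_mul_bot_of_pos (inv_pos.2 hc)]
    | top => simp [EReal.coe_mul_top_of_pos hc, EReal.coe_mul_top_of_pos (inv_pos.2 hc)]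
    | coe w => norm_cast; field_simp; ring
  constructor
  · intro h
    exact ⟨_, h, key z⟩
  · rintro ⟨w, hw, rfl⟩
    rw [key' w]
    exact hw

/-- `(G_u)`, `0 < u < ∞`, is a family of non-degenerate probability distributions on `[-∞, ∞)` with
`K(t u, [-∞, α(t) x + β(t)]) ⇒ G_u([-∞, x])` on `[-∞, ∞]` as `t → ∞`, for every `u`. -/
def IsLimitFamily (K : Kernel PosReal EReal) [IsMarkovKernel K] (α : PosReal → PosReal)
    (β : PosReal → ℝ) (Gu : PosReal → ProbabilityMeasure EReal) : Prop :=
  ∀ u : PosReal, IsNondegenerate (Gu u) ∧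
    Tendsto (fun t : PosReal => scaledLaw K (t * u) (α t) (β t)) atTop (𝓝 (Gu u))

/-! The law of `K` at `t * u` can be normalized in two ways: with `α t`, `β t`, or with `α (t * u)`,
`β (t * u)`, where the limit is `G`. The two normalized laws differ by the affine map with slope `α
(t * u) / α t` and intercept `(β (t * u) - β t) / α t`. If these coefficients converge, the limits
are affine images of one another; conversely, convergence of types recovers convergent coefficients
from non-degenerate limits.

Neither `α` nor `β` is assumed measurable, so the usual theory of regular variation does not apply
directly. Measurability comes from `K` instead.

For necessity, the factors `u` along which the coefficients converge form a multiplicative group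
(`RatioTendsto.mul`, `RatioTendsto.inv`). The limits `Gu u` depend measurably on `u`. Sorting them
by rational quantile levels gives a countable measurable cover, one member of which has positive
measure in the variable `log u`. By Steinhaus' theorem the group is everything
(`IsLimitFamily.exists_ratioTendsto`). The limit coefficients are measurable because they can be
read off from two quantiles of `Gu u`, and their functional equations force the power form
(`exists_exponents`).

For sufficiency and continuous convergence, two quantiles of `K t` are measurable in `t` and
determine `α t`, `β t` asymptotically. This replaces measurability in the uniform convergence
theorem (`IsERV.tendsto_mul`). -/

/-! ### Affine maps of the extended line and their action on laws. -/

/-- The affine bijection `x ↦ a x + b` of `[-∞, ∞]`, for `a > 0`. -/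
noncomputable def affineMap (a : PosReal) (b : ℝ) (x : EReal) : EReal :=
  ((a : ℝ) : EReal) * x + (b : EReal)

theorem affineMap_coe (a : PosReal) (b x : ℝ) :
    affineMap a b (x : EReal) = (((a : ℝ) * x + b : ℝ) : EReal) := by
  simp [affineMap]

theorem affineMap_top (a : PosReal) (b : ℝ) : affineMap a b ⊤ = ⊤ := by
  simp [affineMap, EReal.coe_mul_top_of_pos a.2]

theorem affineMap_bot (a : PosReal) (b : ℝ) : affineMap a b ⊥ = ⊥ := by
  simp [affineMap, EReal.coe_mul_bot_of_pos a.2]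

theorem normMap_eq_affineMap (a : PosReal) (b : ℝ) :
    normMap a b = affineMap ⟨(a : ℝ)⁻¹, inv_pos.2 a.2⟩ (-(b / a)) := by
  have ha := a.2
  funext x
  induction x with
  | bot => simp [normMap, affineMap_bot, EReal.bot_div_of_pos_ne_top (EReal.coe_pos.2 ha)]
  | top => simp [normMap, affineMap_top, EReal.top_div_of_pos_ne_top (EReal.coe_pos.2 ha)]
  | coe x =>
    rw [affineMap_coe, normMap, ← EReal.coe_sub, ← EReal.coe_div]
    congr 1
    simp only
    field_simp
    ring

theorem affineMap_affineMap (a a' : PosReal) (b b' : ℝ) (x : EReal) :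
    affineMap a b (affineMap a' b' x) =
      affineMap ⟨(a : ℝ) * a', mul_pos a.2 a'.2⟩ (a * b' + b) x := by
  induction x with
  | bot => simp [affineMap_bot]
  | top => simp [affineMap_top]
  | coe x =>
    simp only [affineMap_coe]
    congr 1
    ring

/-- Passing from the normalization `(a, b)` to `(a', b')`. -/
theorem normMap_eq_affineMap_normMap (a a' : PosReal) (b b' : ℝ) (x : EReal) :
    normMap a' b' x = affineMap ⟨(a : ℝ) / a', div_pos a.2 a'.2⟩ ((b - b') / a') (normMap a b x) := by
  have ha : (a : ℝ) ≠ 0 := a.2.ne'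
  have ha' : (a' : ℝ) ≠ 0 := a'.2.ne'
  rw [normMap_eq_affineMap, normMap_eq_affineMap, affineMap_affineMap]
  congr 1
  · ext
    simp only
    field_simp
  · simp only
    field_simp
    ring

theorem normMap_affineMap (a : PosReal) (b : ℝ) (x : EReal) :
    normMap a b (affineMap a b x) = x := by
  have ha : (a : ℝ) ≠ 0 := a.2.ne'
  induction x with
  | bot => simp [affineMap_bot, normMap_eq_affineMap]
  | top => simp [affineMap_top, normMap_eq_affineMap]
  | coe x =>
    rw [normMap_eq_affineMap, affineMap_coe, affineMap_coe]
    congr 1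
    simp only
    field_simp
    ring

theorem normMap_le_iff (a : PosReal) (b : ℝ) (x y : EReal) :
    normMap a b x ≤ y ↔ x ≤ affineMap a b y := by
  have ha : (0 : EReal) < ((a : ℝ) : EReal) := by exact_mod_cast a.2
  rw [normMap, EReal.div_le_iff_le_mul ha (EReal.coe_ne_top _),
    EReal.sub_le_iff_le_add (Or.inl (EReal.coe_ne_bot _)) (Or.inl (EReal.coe_ne_top _)), affineMap]

theorem affineMap_normMap (a : PosReal) (b : ℝ) (x : EReal) :
    affineMap a b (normMap a b x) = x := by
  have ha : (a : ℝ) ≠ 0 := a.2.ne'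
  induction x with
  | bot => simp [affineMap_bot, normMap_eq_affineMap]
  | top => simp [affineMap_top, normMap_eq_affineMap]
  | coe x =>
    rw [normMap_eq_affineMap, affineMap_coe, affineMap_coe]
    congr 1
    simp only
    field_simp
    ring

theorem strictMono_affineMap (a : PosReal) (b : ℝ) : StrictMono (affineMap a b) := by
  intro x y h
  rw [← normMap_affineMap a b x, ← normMap_affineMap a b y] at h
  contrapose! h
  rw [normMap_le_iff, affineMap_normMap]
  exact h

theorem affineMap_le_iff (a : PosReal) (b : ℝ) (x y : EReal) :
    affineMap a b x ≤ y ↔ x ≤ normMap a b y := by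
  rw [← (strictMono_affineMap a b).le_iff_le (a := x), affineMap_normMap]

theorem continuous_affineMap :
    Continuous fun p : (PosReal × ℝ) × EReal => affineMap p.1.1 p.1.2 p.2 := by
  rw [continuous_iff_continuousAt]
  rintro ⟨⟨a, b⟩, x⟩
  have ha : ((a : ℝ) : EReal) ≠ 0 := by exact_mod_cast a.2.ne'
  have h1 : Tendsto (fun p : (PosReal × ℝ) × EReal => (((p.1.1 : ℝ) : EReal), p.2))
      (𝓝 ((a, b), x)) (𝓝 (((a : ℝ) : EReal), x)) := by
    apply Continuous.tendsto' _ _ _ rfl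
    exact (continuous_coe_real_ereal.comp (continuous_subtype_val.comp
      (continuous_fst.comp continuous_fst))).prodMk continuous_snd
  have h2 : Tendsto (fun p : (PosReal × ℝ) × EReal => ((p.1.2 : ℝ) : EReal))
      (𝓝 ((a, b), x)) (𝓝 (b : EReal)) := by
    apply Continuous.tendsto' _ _ _ rfl
    exact continuous_coe_real_ereal.comp (continuous_snd.comp continuous_fst)
  have h3 := (EReal.continuousAt_mul (p := (((a : ℝ) : EReal), x)) (Or.inl ha) (Or.inl ha)
    (Or.inl (EReal.coe_ne_bot _)) (Or.inl (EReal.coe_ne_top _))).tendsto.comp h1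
  exact (EReal.continuousAt_add (p := (((a : ℝ) : EReal) * x, (b : EReal)))
    (Or.inr (EReal.coe_ne_bot _)) (Or.inr (EReal.coe_ne_top _))).tendsto.comp (h3.prodMk_nhds h2)

theorem measurable_affineMap (a : PosReal) (b : ℝ) : Measurable (affineMap a b) :=
  (strictMono_affineMap a b).monotone.measurable

/-- The law of `a X + b` when `X` has law `μ`. -/
noncomputable def affineLaw (a : PosReal) (b : ℝ) (μ : ProbabilityMeasure EReal) :
    ProbabilityMeasure EReal :=
  μ.map (measurable_affineMap a b).aemeasurable

theorem affineLaw_apply (a : PosReal) (b : ℝ) (μ : ProbabilityMeasure EReal) {s : Set EReal}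
    (hs : MeasurableSet s) :
    (affineLaw a b μ : Measure EReal) s = (μ : Measure EReal) (affineMap a b ⁻¹' s) :=
  Measure.map_apply (measurable_affineMap a b) hs

/-- Weak convergence is preserved by convergent affine renormalizations. -/
theorem tendsto_affineLaw {ι : Type*} {l : Filter ι} {a : ι → PosReal} {b : ι → ℝ}
    {μ : ι → ProbabilityMeasure EReal} {a₀ : PosReal} {b₀ : ℝ} {μ₀ : ProbabilityMeasure EReal}
    (ha : Tendsto a l (𝓝 a₀)) (hb : Tendsto b l (𝓝 b₀)) (hμ : Tendsto μ l (𝓝 μ₀)) :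
    Tendsto (fun i => affineLaw (a i) (b i) (μ i)) l (𝓝 (affineLaw a₀ b₀ μ₀)) := by
  -- The image law is the pushforward of `δ_(a,b) ⊗ μ` under one jointly continuous map, so varying
  -- coefficients become a varying measure.
  have hT : ∀ (a : PosReal) (b : ℝ) (μ : ProbabilityMeasure EReal),
      affineLaw a b μ = ((diracProba (a, b)).prod μ).map
        (continuous_affineMap.measurable.aemeasurable) := by
    intro a b μ
    apply Subtype.ext
    change (μ : Measure EReal).map (affineMap a b) = ((Measure.dirac (a, b)).prod
      (μ : Measure EReal)).map fun p : (PosReal × ℝ) × EReal => affineMap p.1.1 p.1.2 p.2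
    rw [Measure.dirac_prod, Measure.map_map continuous_affineMap.measurable measurable_prodMk_left]
    rfl
  simp only [hT]
  apply ProbabilityMeasure.tendsto_map_of_tendsto_of_continuous _ _ _ continuous_affineMap
  exact (ProbabilityMeasure.continuous_prod.tendsto (diracProba (a₀, b₀), μ₀)).comp
    (((continuous_diracProba.tendsto (a₀, b₀)).comp (ha.prodMk_nhds hb)).prodMk_nhds hμ)

theorem scaledLaw_eq_affineLaw (K : Kernel PosReal EReal) [IsMarkovKernel K] (y a a' : PosReal)
    (b b' : ℝ) :
    scaledLaw K y a' b' = affineLaw ⟨(a : ℝ) / a', div_pos a.2 a'.2⟩ ((b - b') / a')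
      (scaledLaw K y a b) := by
  apply Subtype.ext
  change (K y).map (normMap a' b') = ((K y).map (normMap a b)).map (affineMap _ _)
  rw [Measure.map_map (measurable_affineMap _ _) (measurable_normMap _ _)]
  congr 1
  funext x
  exact normMap_eq_affineMap_normMap a a' b b' x

theorem tailLaw_eq_affineLaw (ρ k : ℝ) (G : ProbabilityMeasure EReal) (y : PosReal) :
    tailLaw ρ k G y = affineLaw ⟨(y : ℝ) ^ ρ, Real.rpow_pos_of_pos y.2 ρ⟩ (ervPsi ρ k y) G := by
  apply Subtype.ext
  change tailKernel ρ k G y = (G : Measure EReal).map (affineMap _ _)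
  rw [tailKernel, Kernel.map_apply _ (measurable_tailMap ρ k), Kernel.prod_apply,
    Kernel.id_apply, Kernel.const_apply, Measure.dirac_prod,
    Measure.map_map (measurable_tailMap ρ k) measurable_prodMk_left]
  rfl

theorem IsNondegenerate.affineLaw {G : ProbabilityMeasure EReal} (hG : IsNondegenerate G)
    (a : PosReal) (b : ℝ) : IsNondegenerate (affineLaw a b G) := by
  have ha : (a : ℝ) ≠ 0 := a.2.ne'
  refine ⟨?_, fun c => ?_⟩
  · rw [affineLaw_apply _ _ _ (measurableSet_singleton _)]
    convert hG.1
    ext x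
    rw [Set.mem_preimage, Set.mem_singleton_iff, Set.mem_singleton_iff]
    exact ⟨fun h => (strictMono_affineMap a b).injective (h.trans (affineMap_top a b).symm),
      fun h => h ▸ affineMap_top a b⟩
  · have hm : MeasurableSet ((fun x : ℝ => (x : EReal)) '' {x : ℝ | x ≠ c}) :=
      EReal.measurableEmbedding_coe.measurableSet_image.2 (measurableSet_singleton c).compl
    rw [affineLaw_apply _ _ _ hm]
    refine fun h => hG.2 ((c - b) / a) (measure_mono_null ?_ h)
    rintro _ ⟨x, hx, rfl⟩
    refine ⟨a * x + b, fun h => hx ?_, (affineMap_coe a b x).symm⟩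
    rw [← h]
    field_simp
    ring

/-! ### Quantile functions. -/

/-- The left-continuous quantile function of a probability measure on `[-∞, ∞]`. -/
noncomputable def quantile (μ : ProbabilityMeasure EReal) (p : ℝ) : EReal :=
  sInf {x | p ≤ (μ : Measure EReal).real (Set.Iic x)}

/-- Continuity of the measure from above makes the infimum attained. The bound `p ≤ 1` puts `⊤` in
the set, so that it is nonempty. -/
theorem quantile_le_iff (μ : ProbabilityMeasure EReal) {p : ℝ} (hp : p ≤ 1) (x : EReal) :
    quantile μ p ≤ x ↔ p ≤ (μ : Measure EReal).real (Set.Iic x) := by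
  have hne : {x | p ≤ (μ : Measure EReal).real (Set.Iic x)}.Nonempty := ⟨⊤, by simpa using hp⟩
  constructor
  · intro h
    refine le_trans ?_ (measureReal_mono (Set.Iic_subset_Iic.2 h))
    obtain ⟨u, hu, hul, hum⟩ := exists_seq_tendsto_sInf hne (OrderBot.bddBelow _)
    have hI : (⋂ n, Set.Iic (u n)) = Set.Iic (quantile μ p) := by
      ext y
      simp only [Set.mem_iInter, Set.mem_Iic]
      exact ⟨fun hy => ge_of_tendsto' hul hy, fun hy n => hy.trans (sInf_le (hum n))⟩
    have ht := tendsto_measure_iInter_atTop (μ := (μ : Measure EReal))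
      (s := fun n => Set.Iic (u n)) (fun n => measurableSet_Iic.nullMeasurableSet)
      (fun m n hmn => Set.Iic_subset_Iic.2 (hu hmn)) ⟨0, measure_ne_top _ _⟩
    rw [hI] at ht
    exact ge_of_tendsto' ((ENNReal.tendsto_toReal (measure_ne_top _ _)).comp ht) hum
  · exact fun h => sInf_le h

theorem monotone_quantile (μ : ProbabilityMeasure EReal) : Monotone (quantile μ) :=
  fun _ _ h => sInf_le_sInf fun _ hx => h.trans hx

theorem quantile_affineLaw (a : PosReal) (b : ℝ) (μ : ProbabilityMeasure EReal) {p : ℝ}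
    (hp : p ≤ 1) : quantile (affineLaw a b μ) p = affineMap a b (quantile μ p) := by
  refine eq_of_forall_ge_iff fun x => ?_
  rw [quantile_le_iff _ hp, affineMap_le_iff, quantile_le_iff _ hp, measureReal_def,
    affineLaw_apply _ _ _ measurableSet_Iic, measureReal_def]
  have : affineMap a b ⁻¹' Set.Iic x = Set.Iic (normMap a b x) := by
    ext y
    exact affineMap_le_iff a b y x
  rw [this]

/-- Quantiles converge at the continuity points of the limiting quantile function. -/
theorem tendsto_quantile {ι : Type*} {l : Filter ι} {μ : ι → ProbabilityMeasure EReal}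
    {μ₀ : ProbabilityMeasure EReal} (hμ : Tendsto μ l (𝓝 μ₀)) {p : ℝ} (hp0 : 0 < p)
    (hp : p < 1) (hc : ContinuousAt (quantile μ₀) p) :
    Tendsto (fun i => quantile (μ i) p) l (𝓝 (quantile μ₀ p)) := by
  rcases l.eq_or_neBot with rfl | _
  · exact tendsto_bot
  refine tendsto_order.2 ⟨fun x hx => ?_, fun x hx => ?_⟩
  · have hF : (μ₀ : Measure EReal) (Set.Iic x) < ENNReal.ofReal p := by
      rw [ENNReal.lt_ofReal_iff_toReal_lt (measure_ne_top _ _)]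
      contrapose! hx
      exact (quantile_le_iff _ hp.le _).2 hx
    have h := (ProbabilityMeasure.limsup_measure_closed_le_of_tendsto hμ
      (isClosed_Iic (a := x))).trans_lt hF
    filter_upwards [eventually_lt_of_limsup_lt h] with i hi
    rw [ENNReal.lt_ofReal_iff_toReal_lt (measure_ne_top _ _)] at hi
    contrapose! hi
    exact (quantile_le_iff _ hp.le _).1 hi
  · obtain ⟨y, hy, hyx⟩ := exists_between hx
    -- Continuity at `p` enters only here: it leaves room for a level `p' > p`, which makes the next
    -- inequality strict, as the portmanteau bound for open sets requires.
    obtain ⟨p', hp', hp'1, hyp'⟩ : ∃ p', p < p' ∧ p' < 1 ∧ quantile μ₀ p' < y :=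
      (((eventually_mem_nhdsWithin (a := p) (s := Set.Ioi p)).and
        (nhdsWithin_le_nhds ((Iio_mem_nhds hp)))).and
        (nhdsWithin_le_nhds (hc.eventually (Iio_mem_nhds hy)))).exists.imp
        fun _ h => ⟨h.1.1, h.1.2, h.2⟩
    have hF : ENNReal.ofReal p < (μ₀ : Measure EReal) (Set.Iio y) := by
      refine lt_of_lt_of_le ?_ (measure_mono (Set.Iic_subset_Iio.2 hyp'))
      rw [ENNReal.ofReal_lt_iff_lt_toReal hp0.le (measure_ne_top _ _)]
      exact hp'.trans_le ((quantile_le_iff _ hp'1.le _).1 le_rfl)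
    have h := hF.trans_le (ProbabilityMeasure.le_liminf_measure_open_of_tendsto hμ
      (isOpen_Iio (a := y)))
    filter_upwards [eventually_lt_of_lt_liminf h] with i hi
    refine lt_of_le_of_lt ?_ hyx
    rw [quantile_le_iff _ hp.le]
    have := (hi.le.trans (measure_mono Set.Iio_subset_Iic_self))
    exact (ENNReal.ofReal_le_iff_le_toReal (measure_ne_top _ _)).1 this

/-! ### Quantile levels and convergence of types. -/

/-- The level `p` lies strictly between `μ [-∞, a]` and `μ [-∞, b)`. -/
def IsLevel (μ : ProbabilityMeasure EReal) (p a b : ℝ) : Prop :=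
  (μ : Measure EReal).real (Set.Iic (a : EReal)) < p ∧
    p < (μ : Measure EReal).real (Set.Iio (b : EReal))

theorem IsLevel.pos {μ : ProbabilityMeasure EReal} {p a b : ℝ} (h : IsLevel μ p a b) : 0 < p :=
  measureReal_nonneg.trans_lt h.1

theorem IsLevel.lt_one {μ : ProbabilityMeasure EReal} {p a b : ℝ} (h : IsLevel μ p a b) : p < 1 :=
  h.2.trans_le measureReal_le_one

/-- At a level between `a` and `b`, the quantile is a real number in `(a, b]`. -/
theorem IsLevel.exists_quantile_eq {μ : ProbabilityMeasure EReal} {p a b : ℝ}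
    (h : IsLevel μ p a b) : ∃ x : ℝ, quantile μ p = x ∧ a < x ∧ x ≤ b := by
  have h1 : (a : EReal) < quantile μ p := by
    rw [← not_le, quantile_le_iff _ h.lt_one.le, not_le]
    exact h.1
  have h2 : quantile μ p ≤ b :=
    (quantile_le_iff _ h.lt_one.le _).2 (h.2.le.trans (measureReal_mono Set.Iio_subset_Iic_self))
  have h3 : quantile μ p = ((quantile μ p).toReal : EReal) :=
    (EReal.coe_toReal (h2.trans_lt (EReal.coe_lt_top _)).ne (bot_le.trans_lt h1).ne').symm
  refine ⟨_, h3, ?_, ?_⟩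
  · rw [h3] at h1
    exact_mod_cast h1
  · rw [h3] at h2
    exact_mod_cast h2

/-- Levels can be moved to common continuity points of two quantile functions. -/
theorem IsLevel.exists_continuousAt {μ ν : ProbabilityMeasure EReal} {p a b c d : ℝ}
    (hμ : IsLevel μ p a b) (hν : IsLevel ν p c d) :
    ∃ p', IsLevel μ p' a b ∧ IsLevel ν p' c d ∧ ContinuousAt (quantile μ) p' ∧
      ContinuousAt (quantile ν) p' := by
  -- A monotone function has countably many discontinuities, while the admissible levels form a
  -- nonempty open set.
  have hd := (((monotone_quantile μ).countable_not_continuousAt.union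
    (monotone_quantile ν).countable_not_continuousAt).dense_compl ℝ)
  have ho := ((isOpen_Ioo (a := (μ : Measure EReal).real (Set.Iic (a : EReal)))
    (b := (μ : Measure EReal).real (Set.Iio (b : EReal)))).inter
    (isOpen_Ioo (a := (ν : Measure EReal).real (Set.Iic (c : EReal)))
    (b := (ν : Measure EReal).real (Set.Iio (d : EReal)))))
  obtain ⟨p', hp', hc⟩ := hd.inter_open_nonempty _ ho ⟨p, hμ, hν⟩
  simp only [Set.mem_compl_iff, Set.mem_union, Set.mem_ofPred_eq, not_or, not_not] at hc
  exact ⟨p', hp'.1, hp'.2, hc.1, hc.2⟩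

/-- The two levels `p`, `q` are located by two intervals `(a₁, b₁)`, `(a₂, b₂)` in this order. -/
def HasLevels (μ : ProbabilityMeasure EReal) (p q a₁ b₁ a₂ b₂ : ℝ) : Prop :=
  IsLevel μ p a₁ b₁ ∧ IsLevel μ q a₂ b₂ ∧ b₁ ≤ a₂

theorem exists_isLevel {μ : ProbabilityMeasure EReal} {a b : ℝ}
    (h : 0 < (μ : Measure EReal) (Set.Ioo (a : EReal) b)) : ∃ p : ℚ, IsLevel μ p a b := by
  refine exists_rat_btwn ?_
  have hab : (a : EReal) < b := by
    rw [← Set.nonempty_Ioo]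
    exact nonempty_of_measure_ne_zero h.ne'
  have hr : 0 < (μ : Measure EReal).real (Set.Ioo (a : EReal) b) :=
    ENNReal.toReal_pos h.ne' (measure_ne_top _ _)
  rw [← Set.Iic_union_Ioo_eq_Iio hab, measureReal_union _ measurableSet_Ioo]
  · linarith
  · rw [Set.disjoint_left]
    exact fun x hx hx' => not_lt_of_ge hx hx'.1

/-- Non-degeneracy yields two distinct real points of the support, and a rational between them
serves as both `b₁` and `a₂`. All six numbers are rational so that countably many cases cover all
non-degenerate laws. -/
theorem IsNondegenerate.exists_hasLevels {G : ProbabilityMeasure EReal} (hG : IsNondegenerate G) :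
    ∃ p q a₁ b₁ a₂ b₂ : ℚ, HasLevels G p q a₁ b₁ a₂ b₂ := by
  have key : ∀ c : ℝ, ∃ x : ℝ, x ≠ c ∧ ∀ a b : ℝ, a < x → x < b →
      0 < (G : Measure EReal) (Set.Ioo (a : EReal) b) := by
    intro c
    obtain ⟨_, ⟨x, hx, rfl⟩, h⟩ := exists_mem_forall_mem_nhdsWithin_pos_measure (hG.2 c)
    exact ⟨x, hx, fun a b ha hb => h _ (mem_nhdsWithin_of_mem_nhds
      (Ioo_mem_nhds (EReal.coe_lt_coe_iff.2 ha) (EReal.coe_lt_coe_iff.2 hb)))⟩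
  have main : ∀ x y : ℝ, x < y →
      (∀ a b : ℝ, a < x → x < b → 0 < (G : Measure EReal) (Set.Ioo (a : EReal) b)) →
      (∀ a b : ℝ, a < y → y < b → 0 < (G : Measure EReal) (Set.Ioo (a : EReal) b)) →
      ∃ p q a₁ b₁ a₂ b₂ : ℚ, HasLevels G p q a₁ b₁ a₂ b₂ := by
    intro x y hxy hx hy
    obtain ⟨a₁, ha₁⟩ := exists_rat_lt x
    obtain ⟨m, hm, hm'⟩ := exists_rat_btwn hxy
    obtain ⟨b₂, hb₂⟩ := exists_rat_gt y
    obtain ⟨p, hp⟩ := exists_isLevel (hx a₁ m ha₁ hm)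
    obtain ⟨q, hq⟩ := exists_isLevel (hy m b₂ hm' hb₂)
    exact ⟨p, q, a₁, m, m, b₂, hp, hq, le_rfl⟩
  obtain ⟨x, -, hx⟩ := key 0
  obtain ⟨y, hyx, hy⟩ := key x
  rcases hyx.lt_or_gt with h | h
  · exact main y x h hy hx
  · exact main x y h hx hy

/-- Two-point convergence determines the limits of affine coefficients. -/
theorem tendsto_affine_coeff {ι : Type*} {l : Filter ι} {a b x y x' y' : ι → ℝ}
    {x₀ y₀ x₁ y₁ : ℝ} (h : x₀ < y₀) (hx : Tendsto x l (𝓝 x₀)) (hy : Tendsto y l (𝓝 y₀))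
    (hx' : Tendsto x' l (𝓝 x₁)) (hy' : Tendsto y' l (𝓝 y₁))
    (hxe : ∀ᶠ i in l, x' i = a i * x i + b i) (hye : ∀ᶠ i in l, y' i = a i * y i + b i) :
    Tendsto a l (𝓝 ((y₁ - x₁) / (y₀ - x₀))) ∧
      Tendsto b l (𝓝 (x₁ - (y₁ - x₁) / (y₀ - x₀) * x₀)) := by
  have ha : Tendsto a l (𝓝 ((y₁ - x₁) / (y₀ - x₀))) := by
    refine ((hy'.sub hx').div (hy.sub hx) (sub_pos.2 h).ne').congr' ?_
    filter_upwards [hx.eventually_lt hy h, hxe, hye] with i hi h1 h2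
    simp only [Pi.div_apply, h1, h2]
    rw [div_eq_iff (sub_pos.2 hi).ne']
    ring
  refine ⟨ha, (hx'.sub (ha.mul hx)).congr' ?_⟩
  filter_upwards [hxe] with i h1
  simp only [h1]
  ring

/-- The limiting quantile is finite, so the quantiles are eventually finite and the default value of
`toReal` at `±∞` does no harm. -/
theorem tendsto_quantile_toReal {ι : Type*} {l : Filter ι} {μ : ι → ProbabilityMeasure EReal}
    {μ₀ : ProbabilityMeasure EReal} (hμ : Tendsto μ l (𝓝 μ₀)) {p a b : ℝ} (hp : IsLevel μ₀ p a b)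
    (hc : ContinuousAt (quantile μ₀) p) :
    Tendsto (fun i => (quantile (μ i) p).toReal) l (𝓝 (quantile μ₀ p).toReal) ∧
      ∀ᶠ i in l, quantile (μ i) p = ((quantile (μ i) p).toReal : EReal) := by
  obtain ⟨x, hx, -, -⟩ := hp.exists_quantile_eq
  have h := tendsto_quantile hμ hp.pos hp.lt_one hc
  have hb : quantile μ₀ p ≠ ⊥ := by simp [hx]
  have ht : quantile μ₀ p ≠ ⊤ := by simp [hx]
  refine ⟨(EReal.tendsto_toReal ht hb).comp h, ?_⟩
  filter_upwards [h.eventually_ne ht, h.eventually_ne hb] with i h1 h2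
  exact (EReal.coe_toReal h1 h2).symm

/-- Convergence of types: if both limits admit the same pair of levels, then the coefficients of
the affine renormalizations converge. -/
theorem HasLevels.tendsto_coeff {ι : Type*} {l : Filter ι} {a : ι → PosReal} {b : ι → ℝ}
    {μ : ι → ProbabilityMeasure EReal} {μ₀ ν₀ : ProbabilityMeasure EReal}
    (hμ : Tendsto μ l (𝓝 μ₀)) (hν : Tendsto (fun i => affineLaw (a i) (b i) (μ i)) l (𝓝 ν₀))
    {p q a₁ b₁ a₂ b₂ c₁ d₁ c₂ d₂ : ℝ} (h : HasLevels μ₀ p q a₁ b₁ a₂ b₂)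
    (h' : HasLevels ν₀ p q c₁ d₁ c₂ d₂) :
    ∃ (a₀ : PosReal) (b₀ : ℝ), Tendsto a l (𝓝 a₀) ∧ Tendsto b l (𝓝 b₀) := by
  obtain ⟨p', hp, hp', hpc, hpc'⟩ := h.1.exists_continuousAt h'.1
  obtain ⟨q', hq, hq', hqc, hqc'⟩ := h.2.1.exists_continuousAt h'.2.1
  obtain ⟨tp, ep⟩ := tendsto_quantile_toReal hμ hp hpc
  obtain ⟨tp', -⟩ := tendsto_quantile_toReal hν hp' hpc'
  obtain ⟨tq, eq⟩ := tendsto_quantile_toReal hμ hq hqc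
  obtain ⟨tq', -⟩ := tendsto_quantile_toReal hν hq' hqc'
  have hlt : ∀ {κ : ProbabilityMeasure EReal} {a₁ b₁ a₂ b₂ : ℝ}, IsLevel κ p' a₁ b₁ →
      IsLevel κ q' a₂ b₂ → b₁ ≤ a₂ → (quantile κ p').toReal < (quantile κ q').toReal := by
    intro κ a₁ b₁ a₂ b₂ h1 h2 h3
    obtain ⟨x, hx, -, hxb⟩ := h1.exists_quantile_eq
    obtain ⟨y, hy, hya, -⟩ := h2.exists_quantile_eq
    rw [hx, hy, EReal.toReal_coe, EReal.toReal_coe]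
    linarith
  have h0 := hlt hp hq h.2.2
  have h1 := hlt hp' hq' h'.2.2
  have hval : ∀ (r : ℝ) (i : ι), r ≤ 1 →
      quantile (μ i) r = ((quantile (μ i) r).toReal : EReal) →
      (quantile (affineLaw (a i) (b i) (μ i)) r).toReal =
        (a i : ℝ) * (quantile (μ i) r).toReal + b i := by
    intro r i hr he
    rw [quantile_affineLaw _ _ _ hr, he, affineMap_coe, EReal.toReal_coe, EReal.toReal_coe]
  obtain ⟨ha, hb⟩ := tendsto_affine_coeff (a := fun i => (a i : ℝ)) h0 tp tq tp' tq'
    (ep.mono fun i hi => hval _ _ hp.lt_one.le hi) (eq.mono fun i hi => hval _ _ hq.lt_one.le hi)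
  -- The limiting slope is positive because both limit laws have distinct quantiles at the same two
  -- levels.
  exact ⟨⟨_, div_pos (sub_pos.2 h1) (sub_pos.2 h0)⟩, _, tendsto_subtype_rng.2 ha, hb⟩

/-! ### The half line and its exponential parametrization. -/

theorem PosReal.atTop_eq_comap : (atTop : Filter PosReal) = comap Subtype.val atTop :=
  atTop_Ioi_eq (0 : ℝ)

theorem PosReal.tendsto_atTop_iff {ι : Type*} {l : Filter ι} {t : ι → PosReal} :
    Tendsto t l atTop ↔ Tendsto (fun i => (t i : ℝ)) l atTop := by
  rw [PosReal.atTop_eq_comap, tendsto_comap_iff]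
  rfl

theorem PosReal.isCountablyGenerated_atTop : (atTop : Filter PosReal).IsCountablyGenerated := by
  rw [PosReal.atTop_eq_comap]
  infer_instance

theorem PosReal.tendsto_mul_atTop {ι : Type*} {l : Filter ι} {t u : ι → PosReal} {u₀ : PosReal}
    (ht : Tendsto t l atTop) (hu : Tendsto u l (𝓝 u₀)) :
    Tendsto (fun i => t i * u i) l atTop := by
  rw [PosReal.tendsto_atTop_iff] at ht ⊢
  exact ht.atTop_mul_pos u₀.2 (tendsto_subtype_rng.1 hu)

theorem PosReal.tendsto_mul_const_atTop (u : PosReal) :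
    Tendsto (fun t : PosReal => t * u) atTop atTop :=
  PosReal.tendsto_mul_atTop tendsto_id tendsto_const_nhds

theorem PosReal.measurable_const_mul (t : PosReal) : Measurable fun u : PosReal => t * u :=
  Measurable.subtype_mk (measurable_subtype_coe.const_mul (t : ℝ))

/-- The exponential function as a map from `ℝ` to `(0, ∞)`. -/
noncomputable def expPos (s : ℝ) : PosReal := ⟨Real.exp s, Real.exp_pos s⟩

theorem coe_expPos (s : ℝ) : (expPos s : ℝ) = Real.exp s := rfl

theorem measurable_expPos : Measurable expPos := Real.measurable_exp.subtype_mk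

theorem expPos_log (u : PosReal) : expPos (Real.log u) = u := Subtype.ext (Real.exp_log u.2)

theorem expPos_zero : expPos 0 = 1 := Subtype.ext Real.exp_zero

theorem expPos_add (r s : ℝ) : expPos (r + s) = expPos r * expPos s :=
  Subtype.ext (Real.exp_add r s)

theorem expPos_neg (s : ℝ) : expPos (-s) = (expPos s)⁻¹ := Subtype.ext (Real.exp_neg s)

theorem ervPsi_expPos (ρ k s : ℝ) :
    ervPsi ρ k (expPos s) = if ρ = 0 then k * s else k * ρ⁻¹ * (Real.exp (ρ * s) - 1) := by
  rw [ervPsi, coe_expPos, Real.log_exp, ← Real.exp_mul, mul_comm s]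

theorem continuous_ervPsi_expPos (ρ k : ℝ) : Continuous fun s => ervPsi ρ k (expPos s) := by
  simp only [ervPsi_expPos]
  split_ifs <;> fun_prop

/-- The cocycle identity of `ψ`. -/
theorem ervPsi_expPos_add (ρ k r s : ℝ) :
    ervPsi ρ k (expPos (r + s)) =
      ervPsi ρ k (expPos r) + Real.exp (ρ * r) * ervPsi ρ k (expPos s) := by
  simp only [ervPsi_expPos]
  split_ifs with h
  · simp [h]
    ring
  · rw [mul_add, Real.exp_add]
    ring

/-! ### Increments of the normalizing functions and uniform convergence. -/

/-- Pointwise convergence to zero survives bounded translations, along a subsequence and at some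
point. -/
theorem exists_subseq_tendsto_translate {E : Type*} [SeminormedAddCommGroup E]
    {F : ℕ → ℝ → E} (hF : ∀ n, StronglyMeasurable (F n))
    (h0 : ∀ s, Tendsto (fun n => F n s) atTop (𝓝 0)) {v : ℕ → ℝ} {C : ℝ} (hv : ∀ n, |v n| ≤ C) :
    ∃ (m : ℕ → ℕ) (s : ℝ), StrictMono m ∧
      Tendsto (fun n => F (m n) (v (m n) + s)) atTop (𝓝 0) := by
  -- Convergence in measure, unlike pointwise convergence, survives moving translations: the
  -- translates of `[0, 1]` by `v n` stay in `[-C, C + 1]`, and Lebesgue measure is translation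
  -- invariant.
  have h1 : TendstoInMeasure (volume.restrict (Set.Icc (-C) (C + 1))) F atTop (fun _ => (0 : E)) :=
    tendstoInMeasure_of_tendsto_ae (fun n => (hF n).aestronglyMeasurable)
      (Eventually.of_forall h0)
  have h2 : TendstoInMeasure (volume.restrict (Set.Icc (0 : ℝ) 1)) (fun n s => F n (v n + s)) atTop
      (fun _ => (0 : E)) := by
    intro ε hε
    refine tendsto_of_tendsto_of_tendsto_of_le_of_le tendsto_const_nhds (h1 ε hε)
      (fun _ => zero_le) fun n => ?_
    rw [Measure.restrict_apply' measurableSet_Icc, Measure.restrict_apply' measurableSet_Icc]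
    refine le_trans (measure_mono ?_) (measure_preimage_add volume (v n) _).le
    refine fun s hs => ⟨hs.1, ?_⟩
    have h3 := abs_le.1 (hv n)
    have h4 := hs.2
    exact ⟨by linarith [h4.1], by linarith [h4.2]⟩
  obtain ⟨m, hm, hae⟩ := h2.exists_seq_tendsto_ae
  have : (ae (volume.restrict (Set.Icc (0 : ℝ) 1))).NeBot := by
    rw [ae_neBot]
    intro h
    have := congrArg (fun μ => μ Set.univ) h
    simp at this
  obtain ⟨s, hs⟩ := hae.exists
  exact ⟨m, s, hm, hs⟩

/-- The increments of `α`, `β` over a factor `u` converge to `a`, `b`. -/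
def RatioTendsto (α : PosReal → PosReal) (β : PosReal → ℝ) (u : PosReal) (a b : ℝ) : Prop :=
  Tendsto (fun t : PosReal => (α (t * u) : ℝ) / (α t : ℝ)) atTop (𝓝 a) ∧
    Tendsto (fun t : PosReal => (β (t * u) - β t) / (α t : ℝ)) atTop (𝓝 b)

section Ratio

variable {α : PosReal → PosReal} {β : PosReal → ℝ}

theorem RatioTendsto.unique {u : PosReal} {a b a' b' : ℝ} (h : RatioTendsto α β u a b)
    (h' : RatioTendsto α β u a' b') : a = a' ∧ b = b' :=
  ⟨tendsto_nhds_unique h.1 h'.1, tendsto_nhds_unique h.2 h'.2⟩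

theorem RatioTendsto.one : RatioTendsto α β 1 1 0 := by
  have h : ∀ t, (α t : ℝ) ≠ 0 := fun t => (α t).2.ne'
  constructor <;> simp [h]

/-- The increment from `t` to `t * u * v` passes through `t * u`, so the limit coefficients compose
as affine maps. -/
theorem RatioTendsto.mul {u v : PosReal} {a b c d : ℝ} (hu : RatioTendsto α β u a b)
    (hv : RatioTendsto α β v c d) : RatioTendsto α β (u * v) (a * c) (b + a * d) := by
  have h : ∀ t, (α t : ℝ) ≠ 0 := fun t => (α t).2.ne'
  have hs := PosReal.tendsto_mul_const_atTop u
  refine ⟨(hu.1.mul (hv.1.comp hs)).congr fun t => ?_,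
    (hu.2.add (hu.1.mul (hv.2.comp hs))).congr fun t => ?_⟩
  · have h1 := h t
    have h2 := h (t * u)
    rw [Function.comp_apply, ← mul_assoc]
    field_simp
  · have h1 := h t
    have h2 := h (t * u)
    rw [Function.comp_apply, ← mul_assoc]
    field_simp
    ring

theorem RatioTendsto.inv {u : PosReal} {a b : ℝ} (ha : a ≠ 0) (hu : RatioTendsto α β u a b) :
    RatioTendsto α β u⁻¹ a⁻¹ (-(b / a)) := by
  have h : ∀ t, (α t : ℝ) ≠ 0 := fun t => (α t).2.ne'
  have hs := PosReal.tendsto_mul_const_atTop u⁻¹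
  refine ⟨((hu.1.comp hs).inv₀ ha).congr fun t => ?_,
    (((hu.2.comp hs).div (hu.1.comp hs) ha).neg).congr fun t => ?_⟩
  · simp
  · have h1 := h t
    have h2 := h (t * u⁻¹)
    change -((β (t * u⁻¹ * u) - β (t * u⁻¹)) / α (t * u⁻¹) /
      ((α (t * u⁻¹ * u) : ℝ) / α (t * u⁻¹))) = _
    rw [inv_mul_cancel_right]
    field_simp
    ring

/-- Uniform convergence for extended regular variation: measurability is only needed for two
functions `q₁`, `q₂` that determine `α`, `β` asymptotically. -/
theorem IsERV.tendsto_mul {ρ k : ℝ} (h : IsERV α β ρ k) {q₁ q₂ : PosReal → ℝ}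
    (hq₁ : Measurable q₁) (hq₂ : Measurable q₂) {Q₁ Q₂ : ℝ} (hQ : Q₁ < Q₂)
    (h₁ : Tendsto (fun t => (q₁ t - β t) / α t) atTop (𝓝 Q₁))
    (h₂ : Tendsto (fun t => (q₂ t - β t) / α t) atTop (𝓝 Q₂))
    {u : PosReal} {ut : PosReal → PosReal} (hu : Tendsto ut atTop (𝓝 u)) :
    Tendsto (fun t => (α (t * ut t) : ℝ) / α t) atTop (𝓝 ((u : ℝ) ^ ρ)) ∧
      Tendsto (fun t => (β (t * ut t) - β t) / α t) atTop (𝓝 (ervPsi ρ k u)) := by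
  have hα : ∀ t, (α t : ℝ) ≠ 0 := fun t => (α t).2.ne'
  have : (atTop : Filter PosReal).IsCountablyGenerated := PosReal.isCountablyGenerated_atTop
  -- `f Q s` is the limit of `(q (t * expPos s) - β t) / α t` when `(q t - β t) / α t` tends to `Q`.
  set f : ℝ → ℝ → ℝ := fun Q s => Real.exp (ρ * s) * Q + ervPsi ρ k (expPos s) with hf
  have hfc : ∀ Q, Continuous (f Q) := fun Q =>
    (by fun_prop : Continuous fun s => Real.exp (ρ * s) * Q).add (continuous_ervPsi_expPos ρ k)
  have hfa : ∀ Q r s, f Q (r + s) = Real.exp (ρ * r) * f Q s + ervPsi ρ k (expPos r) := by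
    intro Q r s
    simp only [hf, ervPsi_expPos_add, mul_add, Real.exp_add]
    ring
  have hpt : ∀ {q : PosReal → ℝ} {Q : ℝ}, Tendsto (fun t => (q t - β t) / α t) atTop (𝓝 Q) →
      ∀ s, Tendsto (fun t => (q (t * expPos s) - β t) / α t) atTop (𝓝 (f Q s)) := by
    intro q Q hq s
    have hs := hq.comp (PosReal.tendsto_mul_const_atTop (expPos s))
    have he : (expPos s : ℝ) ^ ρ = Real.exp (ρ * s) := by
      rw [coe_expPos, ← Real.exp_mul, mul_comm]
    have h3 := (((h (expPos s)).1.mul hs).add (h (expPos s)).2)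
    rw [he] at h3
    refine h3.congr fun t => ?_
    have h1 := hα t
    have h2 := hα (t * expPos s)
    simp only [Function.comp_apply]
    field_simp
    ring
  suffices hsuf : Tendsto (fun t => ((α (t * ut t) : ℝ) / α t, (β (t * ut t) - β t) / α t)) atTop
      (𝓝 ((u : ℝ) ^ ρ, ervPsi ρ k u)) from
    ⟨(continuous_fst.tendsto _).comp hsuf, (continuous_snd.tendsto _).comp hsuf⟩
  refine tendsto_of_subseq_tendsto fun t ht => ?_
  set v : ℕ → ℝ := fun n => Real.log (ut (t n)) with hvdef
  have hv : Tendsto v atTop (𝓝 (Real.log u)) :=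
    (Real.continuousAt_log u.2.ne').tendsto.comp (tendsto_subtype_rng.1 (hu.comp ht))
  obtain ⟨C, hC⟩ : ∃ C, ∀ n, |v n| ≤ C := by
    obtain ⟨C, hC⟩ := (Metric.isBounded_range_of_tendsto v hv).exists_norm_le
    exact ⟨C, fun n => hC _ ⟨n, rfl⟩⟩
  -- For fixed `n`, `α` and `β` enter only as constants, so measurability in `s` needs only that of
  -- `q₁` and `q₂`.
  set F : ℕ → ℝ → ℝ × ℝ := fun n s =>
    ((q₁ (t n * expPos s) - β (t n)) / α (t n) - f Q₁ s,
      (q₂ (t n * expPos s) - β (t n)) / α (t n) - f Q₂ s) with hFdef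
  have hFm : ∀ n, StronglyMeasurable (F n) := by
    intro n
    have hm : ∀ {q : PosReal → ℝ} (_ : Measurable q) (Q : ℝ), Measurable fun s =>
        (q (t n * expPos s) - β (t n)) / α (t n) - f Q s := fun {q} hq Q =>
      (((hq.comp ((PosReal.measurable_const_mul _).comp measurable_expPos)).sub_const _).div_const
        _).sub (hfc Q).measurable
    exact ((hm hq₁ Q₁).prodMk (hm hq₂ Q₂)).stronglyMeasurable
  have hF0 : ∀ s, Tendsto (fun n => F n s) atTop (𝓝 0) := by
    intro s
    have hz : ∀ {q : PosReal → ℝ} {Q : ℝ}, Tendsto (fun t => (q t - β t) / α t) atTop (𝓝 Q) →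
        Tendsto (fun n => (q (t n * expPos s) - β (t n)) / α (t n) - f Q s) atTop (𝓝 0) := by
      intro q Q hq
      simpa using (((hpt hq s).comp ht).sub_const (f Q s))
    exact (hz h₁).prodMk_nhds (hz h₂)
  obtain ⟨m, s, hm, hs⟩ := exists_subseq_tendsto_translate hFm hF0 hC
  refine ⟨m, ?_⟩
  have hmt := ht.comp hm.tendsto_atTop
  have hvm := hv.comp hm.tendsto_atTop
  have hw : Tendsto (fun n => t (m n) * ut (t (m n))) atTop atTop :=
    PosReal.tendsto_mul_atTop hmt (hu.comp hmt)
  have hleft : ∀ {q : PosReal → ℝ} {Q : ℝ},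
      Tendsto (fun n => (q (t (m n) * expPos (v (m n) + s)) - β (t (m n))) / α (t (m n))
        - f Q (v (m n) + s)) atTop (𝓝 0) →
      Tendsto (fun n => (q (t (m n) * ut (t (m n)) * expPos s) - β (t (m n))) / α (t (m n)))
        atTop (𝓝 (f Q (Real.log u + s))) := by
    intro q Q hq
    have := hq.add (((hfc Q).tendsto _).comp (hvm.add_const s))
    rw [zero_add] at this
    refine this.congr fun n => ?_
    simp only [Function.comp_apply, sub_add_cancel, expPos_add, hvdef, expPos_log, mul_assoc]
  have hl₁ := hleft ((continuous_fst.tendsto _).comp hs)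
  have hl₂ := hleft ((continuous_snd.tendsto _).comp hs)
  have hr₁ := (hpt h₁ s).comp hw
  have hr₂ := (hpt h₂ s).comp hw
  -- The same value of `q` in the normalizations at `t` and at `t * ut t`: these are related by the
  -- affine map with the coefficients sought, and two functions `q` determine it.
  have hid : ∀ (q : PosReal → ℝ) (n : ℕ),
      (q (t (m n) * ut (t (m n)) * expPos s) - β (t (m n))) / α (t (m n)) =
      (α (t (m n) * ut (t (m n))) : ℝ) / α (t (m n)) *
        ((q (t (m n) * ut (t (m n)) * expPos s) - β (t (m n) * ut (t (m n)))) /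
          α (t (m n) * ut (t (m n)))) +
      (β (t (m n) * ut (t (m n))) - β (t (m n))) / α (t (m n)) := by
    intro q n
    have h1 := hα (t (m n))
    have h2 := hα (t (m n) * ut (t (m n)))
    field_simp
    ring
  have hflt : f Q₁ s < f Q₂ s := by
    simp only [hf]
    gcongr
  obtain ⟨ha, hb⟩ := tendsto_affine_coeff hflt hr₁ hr₂ hl₁ hl₂
    (Eventually.of_forall (hid q₁)) (Eventually.of_forall (hid q₂))
  have hc : (f Q₂ (Real.log u + s) - f Q₁ (Real.log u + s)) / (f Q₂ s - f Q₁ s) = (u : ℝ) ^ ρ := by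
    rw [div_eq_iff (sub_pos.2 hflt).ne', hfa, hfa, Real.rpow_def_of_pos u.2, mul_comm ρ]
    ring
  rw [hc] at ha hb
  have hd : f Q₁ (Real.log u + s) - (u : ℝ) ^ ρ * f Q₁ s = ervPsi ρ k u := by
    rw [hfa, Real.rpow_def_of_pos u.2, mul_comm ρ, expPos_log]
    ring
  rw [hd] at hb
  exact ha.prodMk_nhds hb

end Ratio

/-! ### Measurability of quantiles and of weak limits. -/

theorem measurable_quantile {Ω : Type*} [MeasurableSpace Ω] {μ : Ω → ProbabilityMeasure EReal}
    (hμ : ∀ x : EReal, Measurable fun ω => (μ ω : Measure EReal) (Set.Iic x)) {p : ℝ}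
    (hp : p ≤ 1) : Measurable fun ω => quantile (μ ω) p := by
  refine measurable_of_Iic fun x => ?_
  have : (fun ω => quantile (μ ω) p) ⁻¹' Set.Iic x =
      {ω | p ≤ (μ ω : Measure EReal).real (Set.Iic x)} := by
    ext ω
    exact quantile_le_iff _ hp x
  rw [this]
  exact measurableSet_le measurable_const (hμ x).ennreal_toReal

/-- Weak limits of measurable families of probability measures are measurable. -/
theorem measurable_apply_isClosed_of_tendsto {Ω X : Type*} [MeasurableSpace Ω] [TopologicalSpace X]
    [MeasurableSpace X] [OpensMeasurableSpace X] [HasOuterApproxClosed X]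
    {μ : ℕ → Ω → ProbabilityMeasure X} {ν : Ω → ProbabilityMeasure X}
    (hμ : ∀ n, Measurable fun ω => (μ n ω : Measure X))
    (h : ∀ ω, Tendsto (fun n => μ n ω) atTop (𝓝 (ν ω))) {s : Set X} (hs : IsClosed s) :
    Measurable fun ω => (ν ω : Measure X) s := by
  -- The indicator of a closed set is a limit of bounded continuous functions, whose integrals
  -- against `ν ω` are limits of integrals against `μ n ω`.
  refine measurable_of_tendsto_metrizable (fun j => ?_) (tendsto_pi_nhds.2 fun ω =>
    HasOuterApproxClosed.tendsto_lintegral_apprSeq hs (ν ω : Measure X))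
  refine measurable_of_tendsto_metrizable (fun n => ?_) (tendsto_pi_nhds.2 fun ω =>
    ProbabilityMeasure.tendsto_iff_forall_lintegral_tendsto.1 (h ω) (hs.apprSeq j))
  exact (Measure.measurable_lintegral
    (hs.apprSeq j).continuous.measurable.coe_nnreal_ennreal).comp (hμ n)

/-! ### Limit families of kernels and extended regular variation. -/

section Kernel

variable {K : Kernel PosReal EReal} [IsMarkovKernel K] {α : PosReal → PosReal} {β : PosReal → ℝ}
  {G : ProbabilityMeasure EReal} {Gu : PosReal → ProbabilityMeasure EReal}

theorem measurable_scaledLaw (a : PosReal) (b : ℝ) :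
    Measurable fun y => (scaledLaw K y a b : Measure EReal) :=
  (Measure.measurable_map _ (measurable_normMap a b)).comp K.measurable

theorem measurable_scaledLaw_Iic (a : PosReal) (b : ℝ) (x : EReal) :
    Measurable fun y => (scaledLaw K y a b : Measure EReal) (Set.Iic x) :=
  (Measure.measurable_coe measurableSet_Iic).comp (measurable_scaledLaw a b)

/-- The limit may be taken along `t = exp n`. For each fixed `t` the normalization is constant, and
measurability in `u` is that of the kernel. -/
theorem IsLimitFamily.measurable_apply (h : IsLimitFamily K α β Gu) {s : Set EReal}
    (hs : IsClosed s) : Measurable fun u => (Gu u : Measure EReal) s := by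
  have ht : Tendsto (fun n : ℕ => expPos n) atTop atTop :=
    PosReal.tendsto_atTop_iff.2 (Real.tendsto_exp_atTop.comp tendsto_natCast_atTop_atTop)
  exact measurable_apply_isClosed_of_tendsto
    (fun n => (measurable_scaledLaw _ _).comp (PosReal.measurable_const_mul (expPos n)))
    (fun u => (h u).2.comp ht) hs

theorem IsLimitFamily.measurableSet_hasLevels (h : IsLimitFamily K α β Gu)
    (p q a₁ b₁ a₂ b₂ : ℝ) : MeasurableSet {u | HasLevels (Gu u) p q a₁ b₁ a₂ b₂} := by
  have hIic : ∀ a : EReal, Measurable fun u => (Gu u : Measure EReal).real (Set.Iic a) :=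
    fun a => (h.measurable_apply isClosed_Iic).ennreal_toReal
  have hIio : ∀ a : EReal, Measurable fun u => (Gu u : Measure EReal).real (Set.Iio a) := by
    intro a
    have he : ∀ u, (Gu u : Measure EReal).real (Set.Iio a) =
        1 - (Gu u : Measure EReal).real (Set.Ici a) := by
      intro u
      rw [← Set.compl_Ici, probReal_compl_eq_one_sub measurableSet_Ici]
    simp only [he]
    exact (h.measurable_apply isClosed_Ici).ennreal_toReal.const_sub 1
  have hl : ∀ p a b : ℝ, MeasurableSet {u | IsLevel (Gu u) p a b} := fun p a b =>
    (measurableSet_lt (hIic a) measurable_const).inter (measurableSet_lt measurable_const (hIio b))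
  exact (hl p a₁ b₁).inter ((hl q a₂ b₂).inter (MeasurableSet.const _))

/-- The law of `K` at `t * v` is also the law at `(t * (v * u⁻¹)) * u`. Its two normalizations tend
to `Gu v` and `Gu u`, so convergence of types applies; finally `t` is replaced by `t * (u * v⁻¹)`.
-/
theorem IsLimitFamily.exists_ratioTendsto_of_hasLevels (h : IsLimitFamily K α β Gu)
    {p q a₁ b₁ a₂ b₂ : ℝ} {u v : PosReal} (hu : HasLevels (Gu u) p q a₁ b₁ a₂ b₂)
    (hv : HasLevels (Gu v) p q a₁ b₁ a₂ b₂) :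
    ∃ (a : PosReal) (b : ℝ), RatioTendsto α β (u * v⁻¹) a b := by
  have h1 := (h v).2
  have h2 := (h u).2.comp (PosReal.tendsto_mul_const_atTop (v * u⁻¹))
  have h3 : Tendsto (fun t => affineLaw
      ⟨(α t : ℝ) / α (t * (v * u⁻¹)), div_pos (α t).2 (α (t * (v * u⁻¹))).2⟩
      ((β t - β (t * (v * u⁻¹))) / α (t * (v * u⁻¹))) (scaledLaw K (t * v) (α t) (β t)))
      atTop (𝓝 (Gu u)) := by
    refine h2.congr fun t => ?_
    rw [← scaledLaw_eq_affineLaw, Function.comp_apply, mul_assoc, inv_mul_cancel_right]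
  obtain ⟨a, b, ha, hb⟩ := hv.tendsto_coeff h1 h3 hu
  have hs := PosReal.tendsto_mul_const_atTop (u * v⁻¹)
  have hinv : ∀ t : PosReal, t * (u * v⁻¹) * (v * u⁻¹) = t := fun t => by group
  refine ⟨a, b, ((tendsto_subtype_rng.1 ha).comp hs).congr fun t => ?_,
    (hb.comp hs).congr fun t => ?_⟩
  · simp only [Function.comp_apply, hinv]
  · simp only [Function.comp_apply, hinv]

/-- A subgroup of `ℝ` containing the differences of a set of positive measure is everything, so
all increments of the normalizing functions converge. -/
theorem IsLimitFamily.exists_ratioTendsto (h : IsLimitFamily K α β Gu) (u : PosReal) :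
    ∃ (a : PosReal) (b : ℝ), RatioTendsto α β u a b := by
  let H : AddSubgroup ℝ :=
    { carrier := {s | ∃ (a : PosReal) (b : ℝ), RatioTendsto α β (expPos s) a b}
      zero_mem' := ⟨1, 0, by rw [expPos_zero]; exact RatioTendsto.one⟩
      add_mem' := by
        rintro r s ⟨a, b, hr⟩ ⟨c, d, hs⟩
        refine ⟨a * c, b + a * d, ?_⟩
        rw [expPos_add]
        exact hr.mul hs
      neg_mem' := by
        rintro s ⟨a, b, hs⟩
        refine ⟨a⁻¹, -(b / a), ?_⟩
        rw [expPos_neg]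
        exact hs.inv a.2.ne' }
  let V : ℚ × ℚ × ℚ × ℚ × ℚ × ℚ → Set ℝ := fun c =>
    {s | HasLevels (Gu (expPos s)) c.1 c.2.1 c.2.2.1 c.2.2.2.1 c.2.2.2.2.1 c.2.2.2.2.2}
  have hVm : ∀ c, MeasurableSet (V c) := fun c =>
    measurable_expPos (h.measurableSet_hasLevels _ _ _ _ _ _)
  have hV : ⋃ c, V c = Set.univ := by
    refine Set.eq_univ_of_forall fun s => ?_
    obtain ⟨p, q, a₁, b₁, a₂, b₂, hl⟩ := (h (expPos s)).1.exists_hasLevels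
    exact Set.mem_iUnion.2 ⟨(p, q, a₁, b₁, a₂, b₂), hl⟩
  obtain ⟨c, hc⟩ : ∃ c, 0 < volume (V c) := by
    refine exists_measure_pos_of_not_measure_iUnion_null ?_
    rw [hV]
    simp
  -- Steinhaus: the differences of a set of positive measure contain a neighbourhood of zero.
  have hH : (H : Set ℝ) ∈ 𝓝 (0 : ℝ) := by
    refine mem_of_superset (Measure.sub_mem_nhds_zero_of_addHaar_pos volume (V c) (hVm c) hc) ?_
    rintro _ ⟨r, hr, s, hs, rfl⟩
    obtain ⟨a, b, hab⟩ := h.exists_ratioTendsto_of_hasLevels hr hs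
    refine ⟨a, b, ?_⟩
    simp only [sub_eq_add_neg, expPos_add, expPos_neg]
    exact hab
  have hmem : ∀ s : ℝ, s ∈ H := by
    intro s
    -- Some `s / (n + 1)` lies in that neighbourhood, and `s` is a multiple of it.
    have ht : Tendsto (fun n : ℕ => s / (n + 1 : ℕ)) atTop (𝓝 0) :=
      tendsto_const_div_atTop_nhds_zero_nat s |>.comp (tendsto_add_atTop_nat 1)
    obtain ⟨n, hn⟩ := (ht.eventually hH).exists
    have := H.nsmul_mem hn (n + 1)
    rwa [nsmul_eq_mul, mul_div_cancel₀ _ (Nat.cast_ne_zero.2 n.succ_ne_zero)] at this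
  have := hmem (Real.log u)
  change ∃ (a : PosReal) (b : ℝ), RatioTendsto α β (expPos (Real.log u)) a b at this
  rwa [expPos_log] at this

theorem tendsto_scaledLaw_of_ratio
    (hK : Tendsto (fun t : PosReal => scaledLaw K t (α t) (β t)) atTop (𝓝 G))
    {u : PosReal} {ut : PosReal → PosReal} (hu : Tendsto ut atTop (𝓝 u)) {a : PosReal} {b : ℝ}
    (ha : Tendsto (fun t => (α (t * ut t) : ℝ) / α t) atTop (𝓝 a))
    (hb : Tendsto (fun t => (β (t * ut t) - β t) / α t) atTop (𝓝 b)) :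
    Tendsto (fun t => scaledLaw K (t * ut t) (α t) (β t)) atTop (𝓝 (affineLaw a b G)) := by
  have h := tendsto_affineLaw
    (a := fun t => ⟨(α (t * ut t) : ℝ) / α t, div_pos (α (t * ut t)).2 (α t).2⟩)
    (tendsto_subtype_rng.2 ha) hb (hK.comp (PosReal.tendsto_mul_atTop tendsto_id hu))
  refine h.congr fun t => ?_
  rw [scaledLaw_eq_affineLaw K _ (α (t * ut t)) (α t) (β (t * ut t)) (β t)]
  rfl

/-- Measurable additive functions on the real line are linear. -/
theorem exists_eq_mul_of_measurable_of_add {f : ℝ → ℝ} (hf : Measurable f)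
    (hadd : ∀ r s, f (r + s) = f r + f s) : ∃ c, ∀ s, f s = c * s := by
  let φ : ℝ →+ ℝ := AddMonoidHom.mk' f hadd
  have hc : Continuous φ := Measure.AddMonoidHom.continuous_of_measurable φ hf
  refine ⟨f 1, fun s => ?_⟩
  have := map_real_smul φ hc s 1
  simpa [φ, mul_comm] using this

/-- Measurable solutions of the limiting functional equations. -/
theorem exists_exponents {A B : PosReal → ℝ} (hApos : ∀ u, 0 < A u)
    (hAm : Measurable fun s => A (expPos s)) (hBm : Measurable fun s => B (expPos s))
    (hA : ∀ u v, A (u * v) = A u * A v) (hB : ∀ u v, B (u * v) = B u + A u * B v) :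
    ∃ ρ k : ℝ, ∀ u : PosReal, A u = (u : ℝ) ^ ρ ∧ B u = ervPsi ρ k u := by
  obtain ⟨ρ, hρ⟩ := exists_eq_mul_of_measurable_of_add
    (f := fun s => Real.log (A (expPos s))) (Real.measurable_log.comp hAm) fun r s => by
      rw [expPos_add, hA, Real.log_mul (hApos _).ne' (hApos _).ne']
  have hAρ : ∀ s, A (expPos s) = Real.exp (ρ * s) := fun s => by
    rw [← hρ, Real.exp_log (hApos _)]
  suffices hk : ∃ k, ∀ s, B (expPos s) = ervPsi ρ k (expPos s) by
    obtain ⟨k, hk⟩ := hk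
    refine ⟨ρ, k, fun u => ⟨?_, ?_⟩⟩
    · rw [Real.rpow_def_of_pos u.2, mul_comm, ← hAρ, expPos_log]
    · rw [← expPos_log u, hk]
  simp only [ervPsi_expPos]
  by_cases h0 : ρ = 0
  · obtain ⟨k, hk⟩ := exists_eq_mul_of_measurable_of_add hBm fun r s => by
      rw [expPos_add, hB, hAρ, h0, zero_mul, Real.exp_zero, one_mul]
    exact ⟨k, fun s => by rw [if_pos h0, hk]⟩
  -- Expanding `B (expPos s * expPos 1)` in both orders gives `B (expPos s) * (exp ρ - 1) = B
  -- (expPos 1) * (exp (ρ * s) - 1)`, which dictates `k`.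
  · refine ⟨ρ * (B (expPos 1) / (Real.exp ρ - 1)), fun s => ?_⟩
    have he : Real.exp ρ - 1 ≠ 0 := sub_ne_zero.2 (by simpa using h0)
    have h1 := hB (expPos s) (expPos 1)
    have h2 := hB (expPos 1) (expPos s)
    rw [mul_comm, h2, hAρ, hAρ, mul_one] at h1
    rw [if_neg h0]
    field_simp
    linarith

theorem IsLimitFamily.exists_isERV (hG : IsNondegenerate G)
    (hK : Tendsto (fun t : PosReal => scaledLaw K t (α t) (β t)) atTop (𝓝 G))
    (h : IsLimitFamily K α β Gu) : ∃ ρ k : ℝ, IsERV α β ρ k := by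
  choose A B hAB using h.exists_ratioTendsto
  have hGu : ∀ u, Gu u = affineLaw (A u) (B u) G := fun u =>
    tendsto_nhds_unique (h u).2
      (tendsto_scaledLaw_of_ratio hK tendsto_const_nhds (hAB u).1 (hAB u).2)
  obtain ⟨p, q, a₁, b₁, a₂, b₂, hp, hq, hba⟩ := hG.exists_hasLevels
  obtain ⟨x, hx, -, hxb⟩ := hp.exists_quantile_eq
  obtain ⟨y, hy, hya, -⟩ := hq.exists_quantile_eq
  have hxy : x < y := by linarith
  -- The quantiles of `Gu u` at levels `p` and `q` are `A u * x + B u` and `A u * y + B u` with `x <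
  -- y`; solving for `A` and `B` transfers measurability to them.
  have hm : ∀ {r : ℝ}, r ≤ 1 → Measurable fun u => (quantile (Gu u) r).toReal := fun hr =>
    (measurable_quantile (fun _ => h.measurable_apply isClosed_Iic) hr).ereal_toReal
  have hQ : ∀ {r z : ℝ}, r ≤ 1 → quantile G r = z →
      ∀ u, (quantile (Gu u) r).toReal = A u * z + B u := by
    intro r z hr hz u
    rw [hGu, quantile_affineLaw _ _ _ hr, hz, affineMap_coe, EReal.toReal_coe]
  have hmx := hm hp.lt_one.le
  have hmy := hm hq.lt_one.le
  simp only [hQ hp.lt_one.le hx] at hmx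
  simp only [hQ hq.lt_one.le hy] at hmy
  have hAm : Measurable fun u => (A u : ℝ) := by
    have he : ∀ u, (A u * y + B u - (A u * x + B u)) / (y - x) = (A u : ℝ) := fun u => by
      rw [div_eq_iff (sub_pos.2 hxy).ne']
      ring
    simpa only [Pi.sub_apply, he] using (hmy.sub hmx).div_const (y - x)
  have hBm : Measurable B := by
    have he : ∀ u, (A u * x + B u - A u * x : ℝ) = B u := fun u => add_sub_cancel_left _ _
    exact (funext he) ▸ (hmx.sub (hAm.mul_const x))
  obtain ⟨ρ, k, hρ⟩ := exists_exponents (A := fun u => (A u : ℝ)) (B := B) (fun u => (A u).2)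
    (hAm.comp measurable_expPos) (hBm.comp measurable_expPos)
    (fun u v => ((hAB (u * v)).unique ((hAB u).mul (hAB v))).1)
    (fun u v => ((hAB (u * v)).unique ((hAB u).mul (hAB v))).2)
  refine ⟨ρ, k, fun u => ?_⟩
  rw [← (hρ u).1, ← (hρ u).2]
  exact hAB u

/-- With normalization `1`, `0` the law is `K t` itself, so this quantile is measurable in `t` and
can serve as `q₁` or `q₂` in `IsERV.tendsto_mul`. -/
theorem tendsto_quantile_scaledLaw_one {p a b : ℝ}
    (hK : Tendsto (fun t : PosReal => scaledLaw K t (α t) (β t)) atTop (𝓝 G))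
    (hp : IsLevel G p a b) (hc : ContinuousAt (quantile G) p) :
    Tendsto (fun t => ((quantile (scaledLaw K t 1 0) p).toReal - β t) / α t) atTop
      (𝓝 (quantile G p).toReal) := by
  obtain ⟨h1, h2⟩ := tendsto_quantile_toReal hK hp hc
  refine h1.congr' ?_
  filter_upwards [h2] with t ht
  have hα : (α t : ℝ) ≠ 0 := (α t).2.ne'
  rw [scaledLaw_eq_affineLaw K t (α t) 1 (β t) 0, quantile_affineLaw _ _ _ hp.lt_one.le, ht,
    affineMap_coe, EReal.toReal_coe, EReal.toReal_coe]
  simp [hα]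

/-- Continuous convergence to the tail kernel. -/
theorem IsERV.tendsto_scaledLaw {ρ k : ℝ} (h : IsERV α β ρ k) (hG : IsNondegenerate G)
    (hK : Tendsto (fun t : PosReal => scaledLaw K t (α t) (β t)) atTop (𝓝 G))
    {u : PosReal} {ut : PosReal → PosReal} (hu : Tendsto ut atTop (𝓝 u)) :
    Tendsto (fun t : PosReal => scaledLaw K (t * ut t) (α t) (β t)) atTop
      (𝓝 (tailLaw ρ k G u)) := by
  obtain ⟨p, q, a₁, b₁, a₂, b₂, hp, hq, hba⟩ := hG.exists_hasLevels
  obtain ⟨p', hp, -, hpc, -⟩ := hp.exists_continuousAt hp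
  obtain ⟨q', hq, -, hqc, -⟩ := hq.exists_continuousAt hq
  obtain ⟨x, hx, -, hxb⟩ := hp.exists_quantile_eq
  obtain ⟨y, hy, hya, -⟩ := hq.exists_quantile_eq
  have hxy : (quantile G p').toReal < (quantile G q').toReal := by
    rw [hx, hy, EReal.toReal_coe, EReal.toReal_coe]
    linarith
  have hm : ∀ {r : ℝ}, r ≤ 1 →
      Measurable fun t => (quantile (scaledLaw K t 1 0) r).toReal := fun hr =>
    (measurable_quantile (measurable_scaledLaw_Iic 1 0) hr).ereal_toReal
  obtain ⟨ha, hb⟩ := h.tendsto_mul (hm hp.lt_one.le) (hm hq.lt_one.le) hxy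
    (tendsto_quantile_scaledLaw_one hK hp hpc) (tendsto_quantile_scaledLaw_one hK hq hqc) hu
  rw [tailLaw_eq_affineLaw]
  exact tendsto_scaledLaw_of_ratio hK hu ha hb

end Kernel

theorem proposition4p1 (K : Kernel PosReal EReal) [IsMarkovKernel K]
    (α : PosReal → PosReal) (β : PosReal → ℝ) (G : ProbabilityMeasure EReal)
    (hG : IsNondegenerate G)
    (hK : Tendsto (fun t : PosReal => scaledLaw K t (α t) (β t)) atTop (𝓝 G)) :
    ((∃ Gu : PosReal → ProbabilityMeasure EReal, IsLimitFamily K α β Gu) ↔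
      ∃ ρ k : ℝ, IsERV α β ρ k) ∧
    ∀ ρ k : ℝ, IsERV α β ρ k →
      (∀ Gu : PosReal → ProbabilityMeasure EReal, IsLimitFamily K α β Gu →
        Gu 1 = G ∧ ∀ u : PosReal, Gu u = tailLaw ρ k G u) ∧
      ∀ (u : PosReal) (ut : PosReal → PosReal), Tendsto ut atTop (𝓝 u) →
        Tendsto (fun t : PosReal => scaledLaw K (t * ut t) (α t) (β t)) atTop
          (𝓝 (tailLaw ρ k G u)) := by
  refine ⟨⟨fun ⟨Gu, h⟩ => h.exists_isERV hG hK, fun ⟨ρ, k, h⟩ => ⟨tailLaw ρ k G, fun u => ⟨?_,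
    h.tendsto_scaledLaw hG hK tendsto_const_nhds⟩⟩⟩, fun ρ k h => ⟨fun Gu hGu => ⟨?_, fun u =>
    tendsto_nhds_unique (hGu u).2 (h.tendsto_scaledLaw hG hK tendsto_const_nhds)⟩,
    fun u ut hu => h.tendsto_scaledLaw hG hK hu⟩⟩
  · rw [tailLaw_eq_affineLaw]
    exact hG.affineLaw _ _
  · refine tendsto_nhds_unique (hGu 1).2 ?_
    simpa only [mul_one] using hK
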